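/- A probabilistic pushdown automaton (pPDA) $\Delta=(Q,\Gamma,\delta)$ has a finite state set $Q$, a finite stack alphabet $\Gamma$ and transitions $pZ \xrightarrow{a} r\alpha$ with $p,r\in Q$, $Z\in\Gamma$, $\alpha\in\Gamma^*$, $|\alpha|\le 2$ and rational weights $a\ge 0$, such that for every $pZ \in Q\times\Gamma$ the weights of the transitions from $pZ$ sum to $1$. It induces a weighted transition system on the configurations $Q\times\Gamma^*$, in which $pZ\beta$ moves to $r\alpha\beta$ with probability $a$ for every transition $pZ \xrightarrow{a} r\alpha$ and every $\beta\in\Gamma^*$. For $pZq\in Q\times\Gamma\times Q$ let $[pZq]=\sum_\pi \mathrm{p}(\pi)$ be the return probability and $\mathsf{E}[pZq]=\sum_\pi \mathrm{p}(\pi)\,|\pi|\in[0,\infty]$ the first termination moment, where $\pi$ ranges over the finite paths from $pZ$ to $q\varepsilon$, $\mathrm{p}(\pi)$ is the product of the transition probabilities along $\pi$ and $|\pi|$ is its number of steps. $\Delta$ is called cPAST if $\mathsf{E}[pZq]/[pZq]<\infty$ for all $pZq$ with $[pZq]>0$. The fundamental system $f$ of $\Delta$ is the monotone map on $[0,\infty]^{Q\times\Gamma\times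 Q}$ given by $$f(x)_{pZq}=\sum_{pZ\xrightarrow{a}q\varepsilon}a+\sum_{pZ\xrightarrow{a}rY}a\,x_{rYq}+\sum_{pZ\xrightarrow{a}rYX}a\sum_{t\in Q}x_{rYt}\,x_{tXq},$$ and $\mu f$ denotes its least fixed point. **Theorem (Complexity of inductive upper bounds).** There is an absolute constant $K$ such that the following holds. Let $\Delta=(Q,\Gamma,\delta)$ be a pPDA with fundamental system $f$, and suppose that $\Delta$ is cPAST. Let $C=\max\{\mathsf{E}[pZq]/[pZq] : [pZq]>0\}$ be its maximal conditional expected runtime and $m=\min\{[pZq] : [pZq]>0\}$ its minimal non-zero return probability (if all $[pZq]$ are zero, put $C=m=1$). Then for every $\varepsilon>0$ there is a vector $u\in\mathbb{Q}_{\ge 0}^{Q\times\Gamma\times Q}$ with $f(u)\le u$ (componentwise) and $\|\mu f-u\|_\infty\le\varepsilon$, such that every entry of $u$ is a quotient of two integers whose total bit-length is at most $$K\cdot\Big(\log C+\log\tfrac1m+\log|Q|+\log|\Gamma|+\max\{0,\log\tfrac1\varepsilon\}+1\Big).$$ -/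

import Mathlib

open scoped NNReal ENNReal NNRat

universe u v

/-! Weighted transition systems `M` over a state space `S`: paths and termination moments. -/

namespace TransitionSystem

variable {S : Type*}

/-- The weight `∏ M (sᵢ, sᵢ₊₁)` of a path `s₀ … s_l`; paths of length zero have weight 1. -/
noncomputable def pathWeight (M : S → S → ℝ≥0∞) : List S → ℝ≥0∞
  | [] => 1
  | [_] => 1
  | s :: t :: π => M s t * pathWeight M (t :: π)

/-- `π` is a proper path between `s` and `F`: it starts in `s`, ends in `F`, and visits `F`
only at its end. (For `s ∈ F` the only such path is `[s]`.) -/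
def IsProperPath (s : S) (F : Set S) (π : List S) : Prop :=
  π.head? = some s ∧ (∃ t ∈ F, π.getLast? = some t) ∧ ∀ x ∈ π.dropLast, x ∉ F

/-- The `k`-th termination moment `E^k[s|F]`: the sum of `p(π) · |π|^k` over all proper paths
between `s` and `F`, where `|π|` is the number of steps and `0^0 = 1`. -/
noncomputable def moment (M : S → S → ℝ≥0∞) (k : ℕ) (s : S) (F : Set S) : ℝ≥0∞ :=
  ∑' π : {π : List S // IsProperPath s F π},
    pathWeight M π.1 * ((π.1.length - 1 : ℕ) : ℝ≥0∞) ^ k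

end TransitionSystem

/-- Words of length at most two over the stack alphabet. -/
inductive StackWord (Γ : Type v) : Type v
  | nil : StackWord Γ
  | one (Y : Γ) : StackWord Γ
  | two (Y X : Γ) : StackWord Γ

/-- A probabilistic pushdown automaton with finite state set `Q` and finite stack alphabet `Γ`.
`δ p Z r α` is the rational weight of the transition that, in state `p` with `Z` on top of the
stack, moves to state `r` and replaces `Z` by `α` (weight 0 if there is no such transition). -/
structure PPDA (Q : Type u) (Γ : Type v) [Fintype Q] [Fintype Γ] where
  δ : Q → Γ → Q → StackWord Γ → ℚ≥0
  sum_eq_one : ∀ p Z, ∑ r, (δ p Z r .nil + ∑ Y, δ p Z r (.one Y)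
    + ∑ Y, ∑ X, δ p Z r (.two Y X)) = 1

namespace PPDA

variable {Q : Type u} {Γ : Type v} [Fintype Q] [Fintype Γ]

/-- The transition weights as extended non-negative reals. -/
noncomputable def wt (Δ : PPDA Q Γ) (p : Q) (Z : Γ) (r : Q) (α : StackWord Γ) : ℝ≥0∞ :=
  ((Δ.δ p Z r α : ℝ≥0) : ℝ≥0∞)

open Classical in
/-- The transition matrix on the configurations `Q × Γ*`: from `pZβ` the automaton moves to
`rαβ` with weight `δ p Z r α`; configurations with empty stack have no outgoing transition. -/
noncomputable def step (Δ : PPDA Q Γ) : Q × List Γ → Q × List Γ → ℝ≥0∞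
  | (_, []), _ => 0
  | (p, Z :: β), (r, γ) =>
      (if γ = β then Δ.wt p Z r .nil else 0)
      + (∑ Y, if γ = Y :: β then Δ.wt p Z r (.one Y) else 0)
      + ∑ Y, ∑ X, if γ = Y :: X :: β then Δ.wt p Z r (.two Y X) else 0

/-- The return probability `[pZq]`: the 0th termination moment from `pZ` to `qε`. -/
noncomputable def returnProb (Δ : PPDA Q Γ) (p : Q) (Z : Γ) (q : Q) : ℝ≥0∞ :=
  TransitionSystem.moment Δ.step 0 (p, [Z]) {(q, [])}

/-- The first termination moment `E[pZq]` from `pZ` to `qε`. -/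
noncomputable def firstMoment (Δ : PPDA Q Γ) (p : Q) (Z : Γ) (q : Q) : ℝ≥0∞ :=
  TransitionSystem.moment Δ.step 1 (p, [Z]) {(q, [])}

/-- The conditional expected runtime `E[pZq] / [pZq]` (only meaningful if `[pZq] ≠ 0`). -/
noncomputable def condRuntime (Δ : PPDA Q Γ) (p : Q) (Z : Γ) (q : Q) : ℝ≥0∞ :=
  Δ.firstMoment p Z q / Δ.returnProb p Z q

/-- `Δ` is cPAST: all conditional expected runtimes that are defined are finite. -/
def IsCPAST (Δ : PPDA Q Γ) : Prop :=
  ∀ p Z q, Δ.returnProb p Z q ≠ 0 → Δ.condRuntime p Z q < ⊤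

/-- The maximal conditional expected runtime `C`, over all `pZq` with `[pZq] ≠ 0`. -/
noncomputable def maxCondRuntime (Δ : PPDA Q Γ) : ℝ≥0∞ :=
  ⨆ (p : Q) (Z : Γ) (q : Q) (_ : Δ.returnProb p Z q ≠ 0), Δ.condRuntime p Z q

/-- The minimal non-zero return probability. -/
noncomputable def minReturnProb (Δ : PPDA Q Γ) : ℝ≥0∞ :=
  ⨅ (p : Q) (Z : Γ) (q : Q) (_ : Δ.returnProb p Z q ≠ 0), Δ.returnProb p Z q

/-- The fundamental polynomial system `f` of `Δ`, as a monotone map on extended non-negative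
vectors indexed by `Q × Γ × Q`. -/
noncomputable def fundamental (Δ : PPDA Q Γ) :
    (Q × Γ × Q → ℝ≥0∞) →o (Q × Γ × Q → ℝ≥0∞) where
  toFun x := fun ⟨p, Z, q⟩ =>
    Δ.wt p Z q .nil
    + (∑ r, ∑ Y, Δ.wt p Z r (.one Y) * x (r, Y, q))
    + ∑ r, ∑ Y, ∑ X, Δ.wt p Z r (.two Y X) * ∑ t, x (r, Y, t) * x (t, X, q)
  monotone' := by
    rintro x y h ⟨p, Z, q⟩
    dsimp only
    gcongr <;> exact h _

/-- The least fixed point `μf` of the fundamental system. -/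
noncomputable def lfp (Δ : PPDA Q Γ) : Q × Γ × Q → ℝ≥0∞ :=
  OrderHom.lfp Δ.fundamental

end PPDA

/-!
Write `r` for the vector of return probabilities, which is the least fixed point of `f`, and `e` for
the vector of first termination moments. Splitting a run at its first step gives
`r + Df(r) e ≤ e`, so that `e` is a direction in which the linearised system gains a full `r`.
Perturb `r` to `u = r + η e`. The quadratic error in `f(u) ≤ r + η Df(r) e + (η C)² r` is controlled
by `e ≤ C r`, and for `η` of order `C⁻²` the gain beats it: `(1 + η/4) f(u) ≤ u`. This slack is
multiplicative and `f` is quadratic, so every coordinate of `u` may be increased by a relative error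
of `η/16`. Non-zero coordinates are at least `m`, hence rounding up to `k` binary digits with
`2⁻ᵏ ≤ η m / 16` suffices.
-/

lemma add_smul_le_of_le_smul {V : Type*} [AddCommMonoid V] [Module ℝ≥0 V] [PartialOrder V]
    [IsOrderedAddMonoid V] [PosSMulMono ℝ≥0 V] {r e : V} {C : ℝ≥0} (he : e ≤ C • r) (η : ℝ≥0) :
    r + η • e ≤ (1 + η * C) • r :=
  calc r + η • e ≤ r + η • C • r := by gcongr
    _ = (1 + η * C) • r := by rw [add_smul, one_smul, mul_smul]

/-- A quadratic map `x ↦ const + lin x + quad x x` between `ℝ≥0`-modules, kept as its homogeneous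
parts so that it can be expanded and differentiated without subtraction. The fundamental system of
a pPDA is the case `V = Q × Γ × Q → ℝ≥0∞`. -/
structure QuadraticSystem (V : Type*) [AddCommMonoid V] [Module ℝ≥0 V] where
  const : V
  lin : V →ₗ[ℝ≥0] V
  quad : V →ₗ[ℝ≥0] V →ₗ[ℝ≥0] V

namespace QuadraticSystem

section Module

variable {V : Type*} [AddCommMonoid V] [Module ℝ≥0 V]

/-- The value of a quadratic system at a point. -/
def eval (f : QuadraticSystem V) (x : V) : V :=
  f.const + f.lin x + f.quad x x

/-- The derivative of a quadratic system at `x`, applied to the direction `y`. -/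
def deriv (f : QuadraticSystem V) (x y : V) : V :=
  f.lin y + (f.quad y x + f.quad x y)

lemma eval_add_smul (f : QuadraticSystem V) (c : ℝ≥0) (x y : V) :
    f.eval (x + c • y) = f.eval x + c • f.deriv x y + c ^ 2 • f.quad y y := by
  simp only [eval, deriv, map_add, map_smul, LinearMap.add_apply, LinearMap.smul_apply, smul_add,
    smul_smul, pow_two]
  abel

lemma quad_smul_smul (f : QuadraticSystem V) (c : ℝ≥0) (x : V) :
    f.quad (c • x) (c • x) = c ^ 2 • f.quad x x := by
  simp only [map_smul, LinearMap.smul_apply, smul_smul, pow_two]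

end Module

section Order

variable {V : Type*} [AddCommMonoid V] [Module ℝ≥0 V] [PartialOrder V] [CanonicallyOrderedAdd V]

lemma quad_self_le_eval (f : QuadraticSystem V) (x : V) : f.quad x x ≤ f.eval x :=
  le_add_self

lemma quad_self_mono (f : QuadraticSystem V) : Monotone fun x => f.quad x x := by
  intro x y h
  obtain ⟨z, rfl⟩ := le_iff_exists_add.1 h
  simp only [map_add, LinearMap.add_apply, add_assoc]
  exact le_self_add

variable [IsOrderedAddMonoid V]

lemma eval_mono (f : QuadraticSystem V) : Monotone f.eval := by
  intro x y h
  have hlin : f.lin x ≤ f.lin y := by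
    obtain ⟨z, rfl⟩ := le_iff_exists_add.1 h
    exact (map_add f.lin x z).symm ▸ le_self_add
  exact add_le_add (add_le_add_right hlin _) (f.quad_self_mono h)

lemma eval_add_smul_le [PosSMulMono ℝ≥0 V] (f : QuadraticSystem V) {r e : V} {C : ℝ≥0}
    (η : ℝ≥0) (hr : f.eval r ≤ r) (he : e ≤ C • r) :
    f.eval (r + η • e) ≤ r + η • f.deriv r e + (η * C) ^ 2 • r := by
  have hquad : f.quad e e ≤ C ^ 2 • r :=
    calc f.quad e e ≤ f.quad (C • r) (C • r) := f.quad_self_mono he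
      _ = C ^ 2 • f.quad r r := f.quad_smul_smul C r
      _ ≤ C ^ 2 • r := by
        gcongr
        exact (f.quad_self_le_eval r).trans hr
  rw [eval_add_smul, mul_pow, mul_smul]
  gcongr

variable [SMulPosMono ℝ≥0 V]

lemma eval_smul_le (f : QuadraticSystem V) {c : ℝ≥0} (hc : 1 ≤ c) (x : V) :
    f.eval (c • x) ≤ c ^ 2 • f.eval x := by
  have hc2 : c ≤ c ^ 2 := le_self_pow₀ hc two_ne_zero
  calc f.eval (c • x)
      = (1 : ℝ≥0) • f.const + c • f.lin x + c ^ 2 • f.quad x x := by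
        rw [eval, quad_smul_smul, map_smul, one_smul]
    _ ≤ c ^ 2 • f.const + c ^ 2 • f.lin x + c ^ 2 • f.quad x x := by
        gcongr
        exact hc.trans hc2
    _ = c ^ 2 • f.eval x := by simp only [eval, smul_add]

lemma eval_le_self_of_mem_Icc (f : QuadraticSystem V) {κ ρ : ℝ≥0} {u a : V}
    (hu : (1 + κ) • f.eval u ≤ u) (hρ : 1 ≤ ρ) (hρκ : ρ ^ 2 ≤ 1 + κ)
    (ha : a ∈ Set.Icc u (ρ • u)) : f.eval a ≤ a :=
  calc f.eval a ≤ f.eval (ρ • u) := f.eval_mono ha.2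
    _ ≤ ρ ^ 2 • f.eval u := f.eval_smul_le hρ u
    _ ≤ (1 + κ) • f.eval u := by gcongr
    _ ≤ u := hu
    _ ≤ a := ha.1

variable [PosSMulMono ℝ≥0 V] (f : QuadraticSystem V) {r e : V} {C η : ℝ≥0}

lemma eval_add_smul_add_half_smul_le (hr : f.eval r ≤ r) (hre : r + f.deriv r e ≤ e)
    (he : e ≤ C • r) (hη : 2 * (η * C ^ 2) ≤ 1) :
    f.eval (r + η • e) + (η / 2) • r ≤ r + η • e := by
  have hcoeff : (η * C) ^ 2 + η / 2 ≤ η :=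
    calc (η * C) ^ 2 + η / 2 = η / 2 * (2 * (η * C ^ 2)) + η / 2 := by ring
      _ ≤ η / 2 * 1 + η / 2 := by gcongr
      _ = η := by rw [mul_one, add_halves]
  calc f.eval (r + η • e) + (η / 2) • r
      ≤ r + η • f.deriv r e + (η * C) ^ 2 • r + (η / 2) • r := by
        gcongr
        exact f.eval_add_smul_le η hr he
    _ = r + η • f.deriv r e + ((η * C) ^ 2 + η / 2) • r := by
        rw [add_smul, add_assoc _ _ (_ • r)]
    _ ≤ r + η • f.deriv r e + η • r := by gcongr
    _ = r + η • (r + f.deriv r e) := by rw [smul_add, add_assoc, add_comm (η • r)]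
    _ ≤ r + η • e := by gcongr

lemma one_add_smul_eval_le (hr : f.eval r ≤ r) (hre : r + f.deriv r e ≤ e) (he : e ≤ C • r)
    (hηC : η * C ≤ 1) (hη : 2 * (η * C ^ 2) ≤ 1) :
    (1 + η / 4) • f.eval (r + η • e) ≤ r + η • e := by
  have hslack := f.eval_add_smul_add_half_smul_le hr hre he hη
  have hdouble : r + η • e ≤ (2 : ℝ≥0) • r :=
    (add_smul_le_of_le_smul he η).trans (by rw [← one_add_one_eq_two]; gcongr)
  have hhalf : η / 4 * 2 = η / 2 := by
    rw [div_mul_eq_mul_div, div_eq_div_iff four_ne_zero two_ne_zero]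
    ring
  calc (1 + η / 4) • f.eval (r + η • e)
      = f.eval (r + η • e) + (η / 4) • f.eval (r + η • e) := by rw [add_smul, one_smul]
    _ ≤ f.eval (r + η • e) + (η / 4) • (2 : ℝ≥0) • r := by
        gcongr
        exact (le_self_add.trans hslack).trans hdouble
    _ = f.eval (r + η • e) + (η / 2) • r := by rw [smul_smul, hhalf]
    _ ≤ r + η • e := hslack

end Order

end QuadraticSystem

section Rounding

lemma den_natCast_div_natCast_le {n d : ℕ} (hd : d ≠ 0) : ((n : ℚ≥0) / d).den ≤ d := by
  have h : ((n : ℚ≥0) / d).den = Rat.den (Rat.divInt n d) := by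
    rw [← NNRat.den_coe, Rat.divInt_eq_div]
    push_cast
    rfl
  rw [h]
  exact Nat.le_of_dvd (Nat.pos_of_ne_zero hd) (Int.natCast_dvd_natCast.1 (Rat.den_dvd n d))

lemma size_num_add_size_den_le {a : ℚ≥0} {k : ℕ} (ha : a ≤ 2) (hden : a.den ≤ 2 ^ k) :
    Nat.size a.num + Nat.size a.den ≤ 2 * k + 3 := by
  have hnum : a.num ≤ 2 * 2 ^ k := by
    have h : (a.num : ℚ≥0) ≤ 2 * 2 ^ k := by
      rw [← NNRat.mul_den_eq_num]
      gcongr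
      exact_mod_cast hden
    exact_mod_cast h
  have hpow : 0 < 2 ^ k := by positivity
  have hnum_size : Nat.size a.num ≤ k + 2 := Nat.size_le.2 (by rw [pow_add]; omega)
  have hden_size : Nat.size a.den ≤ k + 1 := Nat.size_le.2 (by rw [pow_succ]; omega)
  omega

lemma exists_nnrat_ge_le_add {x : ℝ≥0} (hx : x ≤ 2) (k : ℕ) :
    ∃ a : ℚ≥0, x ≤ a ∧ a ≤ x + (2 ^ k)⁻¹ ∧ Nat.size a.num + Nat.size a.den ≤ 2 * k + 3 := by
  have hceil : ⌈x * 2 ^ k⌉₊ ≤ 2 * 2 ^ k :=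
    Nat.ceil_le.2 (by push_cast; gcongr)
  have hpow : (0 : ℝ≥0) < 2 ^ k := by positivity
  refine ⟨(⌈x * 2 ^ k⌉₊ : ℚ≥0) / (2 ^ k : ℕ), ?_, ?_, size_num_add_size_den_le ?_ ?_⟩
  · push_cast
    exact (le_div_iff₀ hpow).2 (Nat.le_ceil _)
  · push_cast
    rw [div_le_iff₀ hpow, add_mul, inv_mul_cancel₀ hpow.ne']
    exact (Nat.ceil_lt_add_one zero_le).le
  · rw [div_le_iff₀ (by positivity)]
    exact_mod_cast hceil
  · exact den_natCast_div_natCast_le (by positivity)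

lemma exists_nnrat_mem_Icc_mul {x κ m : ℝ≥0} {k : ℕ} (hx : x ≤ 2) (hm : x ≠ 0 → m ≤ x)
    (hk : (2 ^ k)⁻¹ ≤ κ * m) : ∃ a : ℚ≥0, (a : ℝ≥0) ∈ Set.Icc x ((1 + κ) * x) ∧
      Nat.size a.num + Nat.size a.den ≤ 2 * k + 3 := by
  by_cases hx0 : x = 0
  · exact ⟨0, by simp [hx0]⟩
  · obtain ⟨a, hxa, hax, hsize⟩ := exists_nnrat_ge_le_add hx k
    refine ⟨a, ⟨hxa, ?_⟩, hsize⟩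
    calc (a : ℝ≥0) ≤ x + (2 ^ k)⁻¹ := hax
      _ ≤ x + κ * x := by
        gcongr
        exact hk.trans (by gcongr; exact hm hx0)
      _ = (1 + κ) * x := by ring

lemma exists_nat_le_two_pow {x : ℝ} (hx : 1 ≤ x) :
    ∃ k : ℕ, x ≤ 2 ^ k ∧ k * Real.log 2 ≤ Real.log x + Real.log 2 := by
  obtain ⟨n, hle, hlt⟩ := exists_nat_pow_near hx one_lt_two
  refine ⟨n + 1, hlt.le, ?_⟩
  have hlog : n * Real.log 2 ≤ Real.log x := by
    rw [← Real.log_pow]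
    exact Real.log_le_log (by positivity) hle
  push_cast
  linarith

lemma log_max_one {x : ℝ} (hx : 0 < x) : Real.log (max 1 x) = max 0 (Real.log x) := by
  rw [Real.strictMonoOn_log.monotoneOn.map_max (Set.mem_Ioi.2 one_pos) hx, Real.log_one]

end Rounding

section RationalPrefixedPoint

variable {ι : Type*}

lemma exists_nnrat_vector_mem_Icc {x : ι → ℝ≥0∞} {κ m : ℝ≥0} {k : ℕ} (hx : ∀ i, x i ≤ 2)
    (hm : ∀ i, x i ≠ 0 → m ≤ x i) (hk : (2 ^ k)⁻¹ ≤ κ * m) :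
    ∃ a : ι → ℚ≥0, (fun i => ((a i : ℝ≥0) : ℝ≥0∞)) ∈ Set.Icc x ((1 + κ) • x) ∧
      ∀ i, Nat.size (a i).num + Nat.size (a i).den ≤ 2 * k + 3 := by
  lift x to ι → ℝ≥0 using fun i => ne_top_of_le_ne_top ENNReal.ofNat_ne_top (hx i)
  have hround (i : ι) : ∃ a : ℚ≥0, (a : ℝ≥0) ∈ Set.Icc (x i) ((1 + κ) * x i) ∧
      Nat.size a.num + Nat.size a.den ≤ 2 * k + 3 :=
    exists_nnrat_mem_Icc_mul (ENNReal.coe_le_coe.1 (hx i))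
      (fun h => ENNReal.coe_le_coe.1 (hm i (ENNReal.coe_ne_zero.2 h))) hk
  choose a ha hsize using hround
  refine ⟨a, ⟨fun i => ENNReal.coe_le_coe.2 (ha i).1, fun i => ?_⟩, hsize⟩
  exact ENNReal.coe_le_coe.2 (ha i).2

lemma one_add_div_sixteen_mul_le {η C : ℝ≥0} (hC : 1 ≤ C) (hηC : η * C ≤ 1) :
    (1 + η / 16) * (1 + η * C) ≤ 1 + 2 * (η * C ^ 2) :=
  calc (1 + η / 16) * (1 + η * C) = 1 + (η * C + η * (1 + η * C) / 16) := by ring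
    _ ≤ 1 + (η * C ^ 2 + η * C ^ 2) := by
      gcongr
      · exact le_self_pow₀ hC two_ne_zero
      · calc η * (1 + η * C) / 16 ≤ η * (1 + η * C) / 2 := by gcongr; norm_num
          _ ≤ η * (1 + 1) / 2 := by gcongr
          _ = η := by rw [one_add_one_eq_two, mul_div_cancel_right₀ _ two_ne_zero]
          _ ≤ η * C ^ 2 := le_mul_of_one_le_right zero_le (one_le_pow₀ hC)
    _ = 1 + 2 * (η * C ^ 2) := by rw [two_mul]

lemma QuadraticSystem.exists_nnrat_eval_le (f : QuadraticSystem (ι → ℝ≥0∞)) {r e : ι → ℝ≥0∞}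
    {C m η : ℝ≥0} {k : ℕ} (hr : f.eval r ≤ r) (hr1 : r ≤ 1) (hre : r + f.deriv r e ≤ e)
    (he : e ≤ C • r) (hC : 1 ≤ C) (hη : 2 * (η * C ^ 2) ≤ 1) (hm : ∀ i, r i ≠ 0 → m ≤ r i)
    (hk : (2 ^ k)⁻¹ ≤ η / 16 * m) :
    ∃ a : ι → ℚ≥0, let u : ι → ℝ≥0∞ := fun i => ((a i : ℝ≥0) : ℝ≥0∞)
      f.eval u ≤ u ∧ r ≤ u ∧ u ≤ (1 + 2 * (η * C ^ 2)) • r ∧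
      ∀ i, Nat.size (a i).num + Nat.size (a i).den ≤ 2 * k + 3 := by
  have hηC1 : η * C ≤ 1 :=
    calc η * C ≤ η * C ^ 2 := by gcongr; exact le_self_pow₀ hC two_ne_zero
      _ ≤ 2 * (η * C ^ 2) := le_mul_of_one_le_left zero_le one_le_two
      _ ≤ 1 := hη
  have hη1 : η ≤ 1 := (le_mul_of_one_le_right zero_le hC).trans hηC1
  have hu : r + η • e ≤ (1 + η * C) • r := add_smul_le_of_le_smul he η
  have hu2 (i : ι) : (r + η • e) i ≤ 2 :=
    calc (r + η • e) i ≤ (1 + η * C) • r i := hu i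
      _ ≤ (1 + 1 : ℝ≥0) • 1 := by
        gcongr
        exact hr1 i
      _ = 2 := by rw [one_add_one_eq_two]; simp
  have hum (i : ι) (hi : (r + η • e) i ≠ 0) : m ≤ (r + η • e) i := by
    have hri : r i ≠ 0 := fun h => hi <| by simpa [h] using hu i
    exact (hm i hri).trans le_self_add
  have hρ : (1 + η / 16) ^ 2 ≤ 1 + η / 4 := by
    rw [← NNReal.coe_le_coe] at hη1 ⊢
    push_cast at hη1 ⊢
    nlinarith [η.coe_nonneg]
  obtain ⟨a, ha, hsize⟩ := exists_nnrat_vector_mem_Icc hu2 hum hk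
  refine ⟨a, ?_, le_self_add.trans ha.1, ha.2.trans ?_, hsize⟩
  · exact f.eval_le_self_of_mem_Icc (f.one_add_smul_eval_le hr hre he hηC1 hη) le_self_add hρ ha
  · calc (1 + η / 16) • (r + η • e) ≤ (1 + η / 16) • (1 + η * C) • r := by gcongr
      _ ≤ (1 + 2 * (η * C ^ 2)) • r := by
        rw [smul_smul]
        gcongr
        exact one_add_div_sixteen_mul_le hC hηC1

lemma log_mul_sq_mul_div {C M m : ℝ} (hC : C ≠ 0) (hM : M ≠ 0) (hm : m ≠ 0) :
    Real.log (32 * C ^ 2 * M / m) =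
      5 * Real.log 2 + (2 * Real.log C + Real.log M + Real.log (1 / m)) := by
  have h32 : (32 : ℝ) = 2 ^ 5 := by norm_num
  rw [Real.log_div (by positivity) hm, Real.log_mul (by positivity) hM,
    Real.log_mul (by positivity) (by positivity), h32, Real.log_pow, Real.log_pow, one_div,
    Real.log_inv]
  push_cast
  ring

lemma exists_step_precision {C m ε : ℝ≥0} (hC : 1 ≤ C) (hm0 : 0 < m) (hm1 : m ≤ 1) (hε : 0 < ε) :
    ∃ (η : ℝ≥0) (k : ℕ), 2 * (η * C ^ 2) ≤ 1 ∧ 2 * (η * C ^ 2) ≤ ε ∧ (2 ^ k)⁻¹ ≤ η / 16 * m ∧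
      2 * (k : ℝ) + 3 ≤ 15 * (Real.log C + Real.log (1 / m) + max 0 (Real.log (1 / ε)) + 1) := by
  set M : ℝ≥0 := max 1 (1 / ε)
  have hM1 : 1 ≤ M := le_max_left _ _
  have hM0 : 0 < M := one_pos.trans_le hM1
  have hC0 : 0 < C := one_pos.trans_le hC
  have hlogM : Real.log M = max 0 (Real.log (1 / ε)) := by
    rw [← log_max_one (by positivity)]
    push_cast [M]
    rfl
  have hx : 1 ≤ 32 * C ^ 2 * M / m := by
    rw [one_le_div₀ hm0]
    calc m ≤ 1 * 1 * 1 := by rwa [mul_one, mul_one]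
      _ ≤ 32 * C ^ 2 * M := by
        gcongr
        · norm_num
        · exact one_le_pow₀ hC
  obtain ⟨k, hk, hklog⟩ := exists_nat_le_two_pow (NNReal.coe_le_coe.2 hx)
  have hηC : 2 * (1 / (2 * C ^ 2 * M) * C ^ 2) = 1 / M := by field_simp
  refine ⟨1 / (2 * C ^ 2 * M), k, ?_, ?_, ?_, ?_⟩
  · rw [hηC]
    exact (div_le_one₀ hM0).2 hM1
  · rw [hηC, div_le_comm₀ hM0 hε]
    exact le_max_right _ _
  · have hηm : 1 / (2 * C ^ 2 * M) / 16 * m = (32 * C ^ 2 * M / m)⁻¹ := by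
      field_simp
      norm_num
    rw [hηm]
    gcongr
    exact_mod_cast hk
  · push_cast at hklog
    rw [log_mul_sq_mul_div (NNReal.coe_ne_zero.2 hC0.ne') (NNReal.coe_ne_zero.2 hM0.ne')
      (NNReal.coe_ne_zero.2 hm0.ne'), hlogM] at hklog
    have hlogC : 0 ≤ Real.log C := Real.log_nonneg (NNReal.one_le_coe.2 hC)
    have hlogm : 0 ≤ Real.log (1 / m) := Real.log_nonneg ((one_le_div₀ (by positivity)).2 hm1)
    have hε0 : 0 ≤ max 0 (Real.log (1 / ε)) := le_max_left _ _
    set L := 2 * Real.log C + max 0 (Real.log (1 / ε)) + Real.log (1 / m)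
    have hlog2 : 1 / 2 ≤ Real.log 2 := by linarith [Real.log_two_gt_d9]
    have hk6 : (k : ℝ) - 6 ≤ 2 * L :=
      calc (k : ℝ) - 6 ≤ L / Real.log 2 := (le_div_iff₀ (by positivity)).2 (by linarith)
        _ ≤ L / (1 / 2) := by gcongr
        _ = 2 * L := by ring
    linarith

theorem QuadraticSystem.exists_nnrat_eval_le_of_le_smul (f : QuadraticSystem (ι → ℝ≥0∞))
    {r e : ι → ℝ≥0∞} {C m ε : ℝ≥0} (hr : f.eval r ≤ r) (hr1 : r ≤ 1) (hre : r + f.deriv r e ≤ e)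
    (he : e ≤ C • r) (hC : 1 ≤ C) (hm0 : 0 < m) (hm1 : m ≤ 1) (hm : ∀ i, r i ≠ 0 → m ≤ r i)
    (hε : 0 < ε) :
    ∃ a : ι → ℚ≥0, let u : ι → ℝ≥0∞ := fun i => ((a i : ℝ≥0) : ℝ≥0∞)
      f.eval u ≤ u ∧ r ≤ u ∧ u ≤ (1 + ε) • r ∧
      ∀ i, ((Nat.size (a i).num + Nat.size (a i).den : ℕ) : ℝ) ≤
        15 * (Real.log C + Real.log (1 / m) + max 0 (Real.log (1 / ε)) + 1) := by
  obtain ⟨η, k, hη, hηε, hk, hsize_le⟩ := exists_step_precision hC hm0 hm1 hε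
  obtain ⟨a, hfu, hru, hur, hsize⟩ := f.exists_nnrat_eval_le hr hr1 hre he hC hη hm hk
  refine ⟨a, hfu, hru, hur.trans (by gcongr), fun i => le_trans ?_ hsize_le⟩
  exact_mod_cast hsize i

end RationalPrefixedPoint

namespace TransitionSystem

variable {S : Type*}

/-- The sum of `p(π) · g |π|` over all proper paths `π` between `s` and `F`, where `|π|` is the
number of steps. It makes the termination moments computable by one-step unfolding, which shifts
the length function `g`. -/
noncomputable def pathSum (M : S → S → ℝ≥0∞) (g : ℕ → ℝ≥0∞) (s : S) (F : Set S) : ℝ≥0∞ :=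
  ∑' π : {π : List S // IsProperPath s F π}, pathWeight M π.1 * g (π.1.length - 1)

lemma not_isProperPath_nil {s : S} {F : Set S} : ¬ IsProperPath s F [] := by
  simp [IsProperPath]

lemma isProperPath_singleton {s t : S} {F : Set S} :
    IsProperPath s F [t] ↔ t = s ∧ s ∈ F := by
  simp +contextual [IsProperPath, and_congr_right_iff]

lemma isProperPath_cons_cons {s r t : S} {F : Set S} {π : List S} :
    IsProperPath s F (r :: t :: π) ↔ r = s ∧ s ∉ F ∧ IsProperPath t F (t :: π) := by
  simp only [IsProperPath, List.head?_cons, List.getLast?_cons_cons, List.dropLast_cons_cons,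
    List.mem_cons, forall_eq_or_imp, Option.some.injEq, true_and]
  constructor
  · rintro ⟨rfl, hlast, hs, hπ⟩
    exact ⟨rfl, hs, hlast, hπ⟩
  · rintro ⟨rfl, hs, hlast, hπ⟩
    exact ⟨rfl, hlast, hs, hπ⟩

lemma pathSum_of_mem (M : S → S → ℝ≥0∞) (g : ℕ → ℝ≥0∞) {s : S} {F : Set S} (hs : s ∈ F) :
    pathSum M g s F = g 0 := by
  have hpath : ∀ π, IsProperPath s F π ↔ π = [s] := by
    rintro (_ | ⟨r, _ | ⟨t, π⟩⟩)
    · simp [not_isProperPath_nil]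
    · simp [isProperPath_singleton, hs]
    · simp [isProperPath_cons_cons, hs]
  rw [pathSum, tsum_eq_single ⟨[s], (hpath _).2 rfl⟩]
  · simp [pathWeight]
  · rintro ⟨π, hπ⟩ hne
    exact absurd (Subtype.ext ((hpath π).1 hπ)) hne

lemma exists_eq_cons_of_isProperPath {s : S} {F : Set S} (hs : s ∉ F) {π : List S}
    (hπ : IsProperPath s F π) : ∃ t π', π = s :: π' ∧ IsProperPath t F π' := by
  obtain _ | ⟨r, _ | ⟨t, π'⟩⟩ := π
  · exact absurd hπ not_isProperPath_nil
  · exact absurd (isProperPath_singleton.1 hπ).2 hs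
  · obtain ⟨rfl, -, ht⟩ := isProperPath_cons_cons.1 hπ
    exact ⟨t, t :: π', rfl, ht⟩

lemma IsProperPath.exists_eq_cons {t : S} {F : Set S} {π : List S} (hπ : IsProperPath t F π) :
    ∃ π', π = t :: π' :=
  List.head?_eq_some_iff.1 hπ.1

lemma IsProperPath.cons {s t : S} {F : Set S} (hs : s ∉ F) {π : List S}
    (hπ : IsProperPath t F π) : IsProperPath s F (s :: π) := by
  obtain ⟨π', rfl⟩ := hπ.exists_eq_cons
  exact isProperPath_cons_cons.2 ⟨rfl, hs, hπ⟩

lemma pathSum_of_notMem (M : S → S → ℝ≥0∞) (g : ℕ → ℝ≥0∞) {s : S} {F : Set S} (hs : s ∉ F) :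
    pathSum M g s F = ∑' t, M s t * pathSum M (fun n => g (n + 1)) t F := by
  let prepend : (Σ t, {π // IsProperPath t F π}) → {π // IsProperPath s F π} :=
    fun x => ⟨s :: x.2.1, x.2.2.cons hs⟩
  have hprepend : prepend.Bijective := by
    constructor
    · rintro ⟨t, π, hπ⟩ ⟨t', π', hπ'⟩ h
      obtain rfl : π = π' := List.tail_eq_of_cons_eq (congrArg Subtype.val h)
      obtain rfl : t = t' := Option.some.inj (hπ.1.symm.trans hπ'.1)
      rfl
    · rintro ⟨π, hπ⟩
      obtain ⟨t, π', rfl, hπ'⟩ := exists_eq_cons_of_isProperPath hs hπ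
      exact ⟨⟨t, π', hπ'⟩, rfl⟩
  simp only [pathSum, ← ENNReal.tsum_mul_left]
  rw [← (Equiv.ofBijective prepend hprepend).tsum_eq, ENNReal.tsum_sigma']
  refine tsum_congr fun t => tsum_congr fun ⟨π, hπ⟩ => ?_
  obtain ⟨π', rfl⟩ := hπ.exists_eq_cons
  simp [prepend, pathWeight, mul_assoc]

lemma pathSum_le (M : S → S → ℝ≥0∞) (g : ℕ → ℝ≥0∞) (s : S) (F : Set S) :
    pathSum M g s F ≤
      F.indicator (fun _ => g 0) s + ∑' t, M s t * pathSum M (fun n => g (n + 1)) t F := by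
  by_cases hs : s ∈ F
  · rw [pathSum_of_mem M g hs, Set.indicator_of_mem hs]
    exact le_self_add
  · rw [pathSum_of_notMem M g hs]
    exact le_add_self

lemma pathSum_add (M : S → S → ℝ≥0∞) (g h : ℕ → ℝ≥0∞) (s : S) (F : Set S) :
    pathSum M (fun n => g n + h n) s F = pathSum M g s F + pathSum M h s F := by
  simp only [pathSum, mul_add, ENNReal.tsum_add]

lemma pathSum_mul_const (M : S → S → ℝ≥0∞) (g : ℕ → ℝ≥0∞) (c : ℝ≥0∞) (s : S) (F : Set S) :
    pathSum M (fun n => g n * c) s F = pathSum M g s F * c := by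
  simp only [pathSum, ← mul_assoc, ENNReal.tsum_mul_right]

lemma pathSum_const (M : S → S → ℝ≥0∞) (c : ℝ≥0∞) (s : S) (F : Set S) :
    pathSum M (fun _ => c) s F = pathSum M 1 s F * c := by
  simpa using pathSum_mul_const M 1 c s F

lemma pathSum_eq_zero {M : S → S → ℝ≥0∞} {s : S} {F : Set S} (h : pathSum M 1 s F = 0)
    (g : ℕ → ℝ≥0∞) : pathSum M g s F = 0 := by
  simp only [pathSum, Pi.one_apply, mul_one, ENNReal.tsum_eq_zero] at h ⊢
  intro π
  rw [h π, zero_mul]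

variable {ι : Type*} (M : S → S → ℝ≥0∞) {g : ι → ℕ → ℝ≥0∞} {F : ι → Set S} {h : ℕ → S → ℝ≥0∞}

lemma tsum_pathSum_indicator_Iio_le
    (hh : ∀ n s, ∑' i, (F i).indicator (fun _ => g i n) s + ∑' t, M s t * h (n + 1) t ≤ h n s)
    (N n : ℕ) (s : S) :
    ∑' i, pathSum M ((Set.Iio N).indicator fun k => g i (n + k)) s (F i) ≤ h n s := by
  induction N generalizing n s with
  | zero => simp [pathSum]
  | succ N ih =>
    have hshift (i : ι) : (fun k => (Set.Iio (N + 1)).indicator (fun k => g i (n + k)) (k + 1)) =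
        (Set.Iio N).indicator fun k => g i (n + 1 + k) := by
      ext k
      simp [Set.indicator, add_assoc, add_comm 1]
    calc ∑' i, pathSum M ((Set.Iio (N + 1)).indicator fun k => g i (n + k)) s (F i)
        ≤ ∑' i, ((F i).indicator (fun _ => g i n) s + ∑' t, M s t *
            pathSum M ((Set.Iio N).indicator fun k => g i (n + 1 + k)) t (F i)) := by
          refine ENNReal.tsum_le_tsum fun i => (pathSum_le M _ s (F i)).trans_eq ?_
          rw [hshift, Set.indicator_of_mem (Set.mem_Iio.2 N.succ_pos), add_zero]
      _ = ∑' i, (F i).indicator (fun _ => g i n) s + ∑' t, M s t *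
            ∑' i, pathSum M ((Set.Iio N).indicator fun k => g i (n + 1 + k)) t (F i) := by
          rw [ENNReal.tsum_add, ENNReal.tsum_comm]
          simp only [ENNReal.tsum_mul_left]
      _ ≤ ∑' i, (F i).indicator (fun _ => g i n) s + ∑' t, M s t * h (n + 1) t := by
          gcongr with t
          exact ih (n + 1) t
      _ ≤ h n s := hh n s

theorem tsum_pathSum_le
    (hh : ∀ n s, ∑' i, (F i).indicator (fun _ => g i n) s + ∑' t, M s t * h (n + 1) t ≤ h n s)
    (s : S) : ∑' i, pathSum M (g i) s (F i) ≤ h 0 s := by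
  simp only [pathSum]
  rw [← ENNReal.tsum_sigma' fun x : Σ i, {π // IsProperPath s (F i) π} =>
    pathWeight M x.2.1 * g x.1 (x.2.1.length - 1)]
  -- A finite partial sum only sees paths of bounded length.
  rw [ENNReal.tsum_eq_iSup_sum]
  refine iSup_le fun A => ?_
  set N := A.sup fun x => x.2.1.length
  have hN : ∀ x ∈ A, x.2.1.length - 1 < N + 1 := fun x hx =>
    Nat.lt_succ_of_le ((Nat.sub_le _ _).trans (Finset.le_sup (f := fun x => x.2.1.length) hx))
  calc ∑ x ∈ A, pathWeight M x.2.1 * g x.1 (x.2.1.length - 1)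
      = ∑ x ∈ A, pathWeight M x.2.1 *
          (Set.Iio (N + 1)).indicator (fun k => g x.1 (0 + k)) (x.2.1.length - 1) :=
        Finset.sum_congr rfl fun x hx => by
          rw [Set.indicator_of_mem (Set.mem_Iio.2 (hN x hx)), zero_add]
    _ ≤ ∑' x : Σ i, {π // IsProperPath s (F i) π}, pathWeight M x.2.1 *
          (Set.Iio (N + 1)).indicator (fun k => g x.1 (0 + k)) (x.2.1.length - 1) :=
        ENNReal.sum_le_tsum A
    _ = ∑' i, pathSum M ((Set.Iio (N + 1)).indicator fun k => g i (0 + k)) s (F i) :=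
        ENNReal.tsum_sigma' _
    _ ≤ h 0 s := tsum_pathSum_indicator_Iio_le M hh (N + 1) 0 s

end TransitionSystem

namespace StackWord

variable {Γ : Type v}

/-- The list of letters of a stack word, to be pushed onto the remaining stack. -/
def toList : StackWord Γ → List Γ
  | .nil => []
  | .one Y => [Y]
  | .two Y X => [Y, X]

/-- Stack words as optional single letters or pairs of letters, which makes them finite. -/
def equivOption (Γ : Type v) : StackWord Γ ≃ Option (Γ ⊕ Γ × Γ) where
  toFun
    | .nil => none
    | .one Y => some (.inl Y)
    | .two Y X => some (.inr (Y, X))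
  invFun
    | none => .nil
    | some (.inl Y) => .one Y
    | some (.inr (Y, X)) => .two Y X
  left_inv := by rintro (_ | _ | _) <;> rfl
  right_inv := by rintro (_ | _ | ⟨_, _⟩) <;> rfl

noncomputable instance [Fintype Γ] : Fintype (StackWord Γ) :=
  Fintype.ofEquiv _ (equivOption Γ).symm

lemma sum_eq [Fintype Γ] {A : Type*} [AddCommMonoid A] (g : StackWord Γ → A) :
    ∑ α, g α = g .nil + ∑ Y, g (.one Y) + ∑ Y, ∑ X, g (.two Y X) := by
  rw [← (equivOption Γ).symm.sum_comp g, Fintype.sum_option, Fintype.sum_sum_type,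
    Fintype.sum_prod_type, add_assoc]
  rfl

end StackWord

namespace PPDA

section StackMatrix

variable {Q : Type u} {Γ : Type v} [Fintype Q]

open Classical in
/-- The extension of a vector `x` from stack letters to stack contents `α`: its `(p, q)` entry
is the value that `x` assigns to the triple `pαq`. -/
noncomputable def stackMatrix (x : Q × Γ × Q → ℝ≥0∞) (α : List Γ) : Matrix Q Q ℝ≥0∞ :=
  (α.map fun Z => Matrix.of fun p q => x (p, Z, q)).prod

lemma stackMatrix_append_apply (x : Q × Γ × Q → ℝ≥0∞) (α β : List Γ) (p q : Q) :
    stackMatrix x (α ++ β) p q = ∑ t, stackMatrix x α p t * stackMatrix x β t q := by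
  classical
  rw [stackMatrix, List.map_append, List.prod_append, Matrix.mul_apply]
  rfl

lemma stackMatrix_singleton_apply (x : Q × Γ × Q → ℝ≥0∞) (Z : Γ) (p q : Q) :
    stackMatrix x [Z] p q = x (p, Z, q) := by
  simp [stackMatrix]

end StackMatrix

variable {Q : Type u} {Γ : Type v} [Fintype Q] [Fintype Γ]

section Unfolding

lemma sum_wt_eq_one (Δ : PPDA Q Γ) (p : Q) (Z : Γ) : ∑ r, ∑ α, Δ.wt p Z r α = 1 := by
  have hδ : ∑ r, ∑ α, Δ.δ p Z r α = 1 := by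
    simpa only [StackWord.sum_eq] using Δ.sum_eq_one p Z
  calc ∑ r, ∑ α, Δ.wt p Z r α = ((∑ r, ∑ α, Δ.δ p Z r α : ℚ≥0) : ℝ≥0) := by
        push_cast
        rfl
    _ = 1 := by simp [hδ]

lemma tsum_step_cons_mul (Δ : PPDA Q Γ) (p : Q) (Z : Γ) (β : List Γ)
    (g : Q × List Γ → ℝ≥0∞) :
    ∑' c, Δ.step (p, Z :: β) c * g c =
      ∑ r, ∑ α, Δ.wt p Z r α * g (r, α.toList ++ β) := by
  classical
  rw [ENNReal.tsum_prod', tsum_fintype]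
  refine Finset.sum_congr rfl fun r _ => ?_
  simp only [step, add_mul, Finset.sum_mul, ite_mul, zero_mul]
  rw [ENNReal.tsum_add, ENNReal.tsum_add, Summable.tsum_finsetSum fun _ _ => ENNReal.summable,
    Summable.tsum_finsetSum fun _ _ => ENNReal.summable]
  simp only [Summable.tsum_finsetSum fun _ _ => ENNReal.summable]
  simp [tsum_ite_eq, StackWord.sum_eq, StackWord.toList]

/-- The sum of `p(π) · g |π|` over all paths `π` from `pα` to `qε`: the return probability and the
first termination moment, extended from single letters to arbitrary stack contents `α`. -/
noncomputable def emptyingSum (Δ : PPDA Q Γ) (g : ℕ → ℝ≥0∞) (p : Q) (α : List Γ) (q : Q) : ℝ≥0∞ :=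
  TransitionSystem.pathSum Δ.step g (p, α) {(q, [])}

open Classical in
lemma emptyingSum_nil (Δ : PPDA Q Γ) (g : ℕ → ℝ≥0∞) (p q : Q) :
    Δ.emptyingSum g p [] q = if p = q then g 0 else 0 := by
  rw [emptyingSum]
  split_ifs with h
  · exact TransitionSystem.pathSum_of_mem _ g (by simp [h])
  · rw [TransitionSystem.pathSum_of_notMem _ g (by simp [h])]
    simp [step]

lemma emptyingSum_cons (Δ : PPDA Q Γ) (g : ℕ → ℝ≥0∞) (p : Q) (Z : Γ) (β : List Γ) (q : Q) :
    Δ.emptyingSum g p (Z :: β) q =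
      ∑ r, ∑ α, Δ.wt p Z r α * Δ.emptyingSum (fun n => g (n + 1)) r (α.toList ++ β) q := by
  rw [emptyingSum, TransitionSystem.pathSum_of_notMem _ g (by simp), tsum_step_cons_mul]
  rfl

lemma sum_emptyingSum_le (Δ : PPDA Q Γ) {g : Q → ℕ → ℝ≥0∞} {h : ℕ → Q → List Γ → ℝ≥0∞}
    (hnil : ∀ n p, g p n ≤ h n p [])
    (hcons : ∀ n p Z β, ∑ r, ∑ α, Δ.wt p Z r α * h (n + 1) r (α.toList ++ β) ≤ h n p (Z :: β))
    (p : Q) (α : List Γ) :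
    ∑ q, Δ.emptyingSum (g q) p α q ≤ h 0 p α := by
  classical
  rw [← tsum_fintype (L := .unconditional _)]
  refine TransitionSystem.tsum_pathSum_le Δ.step (h := fun n c => h n c.1 c.2) ?_ (p, α)
  rintro n ⟨p, _ | ⟨Z, β⟩⟩
  · simpa [Set.indicator, step] using hnil n p
  · rw [tsum_step_cons_mul]
    simpa [Set.indicator] using hcons n p Z β

lemma emptyingSum_le (Δ : PPDA Q Γ) {g : ℕ → ℝ≥0∞} {h : ℕ → Q → List Γ → ℝ≥0∞} {q : Q}
    (hnil : ∀ n, g n ≤ h n q [])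
    (hcons : ∀ n p Z β, ∑ r, ∑ α, Δ.wt p Z r α * h (n + 1) r (α.toList ++ β) ≤ h n p (Z :: β))
    (p : Q) (α : List Γ) :
    Δ.emptyingSum g p α q ≤ h 0 p α := by
  classical
  let g' : Q → ℕ → ℝ≥0∞ := Pi.single q g
  have hg' : g' q = g := Pi.single_eq_same (M := fun _ : Q => ℕ → ℝ≥0∞) q g
  have hnil' (n : ℕ) (t : Q) : g' t n ≤ h n t [] := by
    obtain rfl | ht := eq_or_ne t q
    · rw [hg']
      exact hnil n
    · simp [g', Pi.single_eq_of_ne ht]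
  calc Δ.emptyingSum g p α q = Δ.emptyingSum (g' q) p α q := by rw [hg']
    _ ≤ ∑ t, Δ.emptyingSum (g' t) p α t :=
        Finset.single_le_sum_of_canonicallyOrdered (f := fun t => Δ.emptyingSum (g' t) p α t)
          (Finset.mem_univ q)
    _ ≤ h 0 p α := Δ.sum_emptyingSum_le hnil' hcons p α

lemma sum_emptyingSum_append_le (Δ : PPDA Q Γ) (g : ℕ → ℝ≥0∞) (p : Q) (α β : List Γ) (q : Q) :
    ∑ t, Δ.emptyingSum (fun i => Δ.emptyingSum (fun j => g (i + j)) t β q) p α t ≤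
      Δ.emptyingSum g p (α ++ β) q := by
  have h := Δ.sum_emptyingSum_le
    (h := fun n p α => Δ.emptyingSum (fun j => g (n + j)) p (α ++ β) q)
    (fun n t => le_refl (Δ.emptyingSum (fun j => g (n + j)) t β q)) (fun n p Z γ => ?_) p α
  · simpa only [zero_add] using h
  · simp only [List.cons_append, emptyingSum_cons Δ (fun j => g (n + j)), List.append_assoc,
      add_assoc, add_comm 1, le_refl]

lemma sum_emptyingSum_one_mul_le (Δ : PPDA Q Γ) (p : Q) (α β : List Γ) (q : Q) :
    ∑ t, Δ.emptyingSum 1 p α t * Δ.emptyingSum 1 t β q ≤ Δ.emptyingSum 1 p (α ++ β) q := by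
  refine le_trans (Finset.sum_le_sum fun t _ => ?_) (Δ.sum_emptyingSum_append_le 1 p α β q)
  exact (TransitionSystem.pathSum_const Δ.step (Δ.emptyingSum 1 t β q) _ _).ge

lemma sum_emptyingSum_cast_mul_le (Δ : PPDA Q Γ) (p : Q) (α β : List Γ) (q : Q) :
    ∑ t, (Δ.emptyingSum Nat.cast p α t * Δ.emptyingSum 1 t β q +
        Δ.emptyingSum 1 p α t * Δ.emptyingSum Nat.cast t β q) ≤
      Δ.emptyingSum Nat.cast p (α ++ β) q := by
  have hinner (t : Q) (i : ℕ) : Δ.emptyingSum (fun j => ((i + j : ℕ) : ℝ≥0∞)) t β q =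
      i * Δ.emptyingSum 1 t β q + Δ.emptyingSum Nat.cast t β q := by
    simp only [emptyingSum, Nat.cast_add, TransitionSystem.pathSum_add,
      TransitionSystem.pathSum_const, mul_comm (i : ℝ≥0∞)]
  have happend := Δ.sum_emptyingSum_append_le Nat.cast p α β q
  simp only [hinner] at happend
  simpa only [emptyingSum, TransitionSystem.pathSum_add, TransitionSystem.pathSum_const,
    TransitionSystem.pathSum_mul_const] using happend

lemma returnProb_eq_emptyingSum (Δ : PPDA Q Γ) (p : Q) (Z : Γ) (q : Q) :
    Δ.returnProb p Z q = Δ.emptyingSum 1 p [Z] q := by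
  simp [returnProb, TransitionSystem.moment, emptyingSum, TransitionSystem.pathSum]

lemma firstMoment_eq_emptyingSum (Δ : PPDA Q Γ) (p : Q) (Z : Γ) (q : Q) :
    Δ.firstMoment p Z q = Δ.emptyingSum Nat.cast p [Z] q := by
  simp [firstMoment, TransitionSystem.moment, emptyingSum, TransitionSystem.pathSum]

lemma returnProb_le_one (Δ : PPDA Q Γ) (p : Q) (Z : Γ) (q : Q) : Δ.returnProb p Z q ≤ 1 := by
  rw [returnProb_eq_emptyingSum]
  refine Δ.emptyingSum_le (h := fun _ _ _ => 1) (fun _ => le_rfl) (fun _ p Z _ => ?_) p [Z]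
  simp only [mul_one]
  exact (Δ.sum_wt_eq_one p Z).le

lemma firstMoment_eq_zero (Δ : PPDA Q Γ) {p : Q} {Z : Γ} {q : Q} (h : Δ.returnProb p Z q = 0) :
    Δ.firstMoment p Z q = 0 := by
  rw [returnProb_eq_emptyingSum] at h
  rw [firstMoment_eq_emptyingSum]
  exact TransitionSystem.pathSum_eq_zero h _

lemma firstMoment_eq_returnProb_add (Δ : PPDA Q Γ) (p : Q) (Z : Γ) (q : Q) :
    Δ.firstMoment p Z q =
      Δ.returnProb p Z q + ∑ r, ∑ α, Δ.wt p Z r α * Δ.emptyingSum Nat.cast r α.toList q := by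
  rw [firstMoment_eq_emptyingSum, returnProb_eq_emptyingSum, emptyingSum_cons, emptyingSum_cons,
    add_comm]
  simp only [← Finset.sum_add_distrib, ← mul_add, Nat.cast_add, Nat.cast_one, List.append_nil]
  simp only [emptyingSum, TransitionSystem.pathSum_add]
  rfl

end Unfolding

section FixedPoint

/-- The vector of all return probabilities `[pZq]`. -/
noncomputable def returnVec (Δ : PPDA Q Γ) : Q × Γ × Q → ℝ≥0∞ :=
  fun ⟨p, Z, q⟩ => Δ.returnProb p Z q

/-- The vector of all first termination moments `E[pZq]`. -/
noncomputable def momentVec (Δ : PPDA Q Γ) : Q × Γ × Q → ℝ≥0∞ :=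
  fun ⟨p, Z, q⟩ => Δ.firstMoment p Z q

lemma fundamental_apply (Δ : PPDA Q Γ) (x : Q × Γ × Q → ℝ≥0∞) (p : Q) (Z : Γ) (q : Q) :
    Δ.fundamental x (p, Z, q) = Δ.wt p Z q .nil
      + (∑ r, ∑ Y, Δ.wt p Z r (.one Y) * x (r, Y, q))
      + ∑ r, ∑ Y, ∑ X, Δ.wt p Z r (.two Y X) * ∑ t, x (r, Y, t) * x (t, X, q) :=
  rfl

lemma fundamental_eq_sum_stackMatrix (Δ : PPDA Q Γ) (x : Q × Γ × Q → ℝ≥0∞) (p : Q) (Z : Γ)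
    (q : Q) :
    Δ.fundamental x (p, Z, q) = ∑ r, ∑ α, Δ.wt p Z r α * stackMatrix x α.toList r q := by
  classical
  simp [fundamental_apply, StackWord.sum_eq, StackWord.toList, stackMatrix, Finset.sum_add_distrib,
    Matrix.mul_apply, Matrix.one_apply]

lemma stackMatrix_returnVec_le (Δ : PPDA Q Γ) (p : Q) (α : List Γ) (q : Q) :
    stackMatrix Δ.returnVec α p q ≤ Δ.emptyingSum 1 p α q := by
  induction α generalizing p with
  | nil => simp [stackMatrix, emptyingSum_nil, Matrix.one_apply]
  | cons Z β ih =>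
    rw [← List.singleton_append, stackMatrix_append_apply]
    refine le_trans (Finset.sum_le_sum fun t _ => ?_) (Δ.sum_emptyingSum_one_mul_le p [Z] β q)
    gcongr
    · rw [stackMatrix_singleton_apply, ← returnProb_eq_emptyingSum]
      rfl
    · exact ih t

lemma fundamental_returnVec_le (Δ : PPDA Q Γ) : Δ.fundamental Δ.returnVec ≤ Δ.returnVec := by
  rintro ⟨p, Z, q⟩
  rw [returnVec, fundamental_eq_sum_stackMatrix, returnProb_eq_emptyingSum, emptyingSum_cons]
  gcongr
  rw [List.append_nil]
  exact Δ.stackMatrix_returnVec_le _ _ q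

lemma returnVec_le_of_fundamental_le (Δ : PPDA Q Γ) {x : Q × Γ × Q → ℝ≥0∞}
    (hx : Δ.fundamental x ≤ x) : Δ.returnVec ≤ x := by
  rintro ⟨p, Z, q⟩
  rw [returnVec, returnProb_eq_emptyingSum, ← stackMatrix_singleton_apply x]
  refine Δ.emptyingSum_le (h := fun _ p α => stackMatrix x α p q)
    (fun _ => by simp [stackMatrix]) (fun _ p Z β => ?_) p [Z]
  calc ∑ r, ∑ α, Δ.wt p Z r α * stackMatrix x (α.toList ++ β) r q
      = ∑ t, Δ.fundamental x (p, Z, t) * stackMatrix x β t q := by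
        simp only [fundamental_eq_sum_stackMatrix, stackMatrix_append_apply, Finset.sum_mul,
          Finset.mul_sum, mul_assoc]
        exact (Finset.sum_comm.trans (Finset.sum_congr rfl fun r _ => Finset.sum_comm)).symm
    _ ≤ ∑ t, stackMatrix x [Z] p t * stackMatrix x β t q := by
        gcongr
        rw [stackMatrix_singleton_apply]
        exact hx _
    _ = stackMatrix x (Z :: β) p q := (stackMatrix_append_apply x [Z] β p q).symm

lemma lfp_eq_returnVec (Δ : PPDA Q Γ) : Δ.lfp = Δ.returnVec :=
  le_antisymm (OrderHom.lfp_le _ Δ.fundamental_returnVec_le)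
    (Δ.returnVec_le_of_fundamental_le (OrderHom.map_lfp Δ.fundamental).le)

end FixedPoint

end PPDA

namespace PPDA

variable {Q : Type u} {Γ : Type v} [Fintype Q] [Fintype Γ]

section QuadraticSystem

/-- The fundamental system split into its constant, linear and quadratic parts, which come from
the transitions that push zero, one and two letters. -/
noncomputable def quadraticSystem (Δ : PPDA Q Γ) : QuadraticSystem (Q × Γ × Q → ℝ≥0∞) where
  const := fun ⟨p, Z, q⟩ => Δ.wt p Z q .nil
  lin :=
    { toFun x := fun ⟨p, Z, q⟩ => ∑ r, ∑ Y, Δ.wt p Z r (.one Y) * x (r, Y, q)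
      map_add' x y := by
        ext ⟨p, Z, q⟩
        simp only [Pi.add_apply, mul_add, Finset.sum_add_distrib]
      map_smul' c x := by
        ext ⟨p, Z, q⟩
        simp only [Pi.smul_apply, mul_smul_comm, Finset.smul_sum, RingHom.id_apply] }
  quad := LinearMap.mk₂ ℝ≥0
    (fun x y ⟨p, Z, q⟩ =>
      ∑ r, ∑ Y, ∑ X, Δ.wt p Z r (.two Y X) * ∑ t, x (r, Y, t) * y (t, X, q))
    (fun x x' y => by
      ext ⟨p, Z, q⟩
      simp only [Pi.add_apply, add_mul, mul_add, Finset.sum_add_distrib])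
    (fun c x y => by
      ext ⟨p, Z, q⟩
      simp only [Pi.smul_apply, smul_mul_assoc, mul_smul_comm, ← Finset.smul_sum])
    (fun x y y' => by
      ext ⟨p, Z, q⟩
      simp only [Pi.add_apply, mul_add, Finset.sum_add_distrib])
    (fun c x y => by
      ext ⟨p, Z, q⟩
      simp only [Pi.smul_apply, mul_smul_comm, ← Finset.smul_sum])

lemma eval_quadraticSystem (Δ : PPDA Q Γ) (x : Q × Γ × Q → ℝ≥0∞) :
    Δ.quadraticSystem.eval x = Δ.fundamental x :=
  rfl

lemma deriv_quadraticSystem_apply (Δ : PPDA Q Γ) (x y : Q × Γ × Q → ℝ≥0∞) (p : Q) (Z : Γ)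
    (q : Q) :
    Δ.quadraticSystem.deriv x y (p, Z, q) =
      ∑ r, (∑ Y, Δ.wt p Z r (.one Y) * y (r, Y, q) + ∑ Y, ∑ X, Δ.wt p Z r (.two Y X) *
        ∑ t, (y (r, Y, t) * x (t, X, q) + x (r, Y, t) * y (t, X, q))) := by
  simp only [Finset.sum_add_distrib, mul_add]
  rfl

lemma returnVec_add_deriv_le (Δ : PPDA Q Γ) :
    Δ.returnVec + Δ.quadraticSystem.deriv Δ.returnVec Δ.momentVec ≤ Δ.momentVec := by
  rintro ⟨p, Z, q⟩
  have hone (r : Q) (Y : Γ) : Δ.momentVec (r, Y, q) = Δ.emptyingSum Nat.cast r [Y] q :=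
    Δ.firstMoment_eq_emptyingSum r Y q
  have htwo (r : Q) (Y X : Γ) :
      ∑ t, (Δ.momentVec (r, Y, t) * Δ.returnVec (t, X, q) +
          Δ.returnVec (r, Y, t) * Δ.momentVec (t, X, q)) ≤
        Δ.emptyingSum Nat.cast r [Y, X] q := by
    simpa only [returnVec, momentVec, firstMoment_eq_emptyingSum, returnProb_eq_emptyingSum,
      List.cons_append, List.nil_append]
      using Δ.sum_emptyingSum_cast_mul_le r [Y] [X] q
  calc (Δ.returnVec + Δ.quadraticSystem.deriv Δ.returnVec Δ.momentVec) (p, Z, q)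
      = Δ.returnProb p Z q + Δ.quadraticSystem.deriv Δ.returnVec Δ.momentVec (p, Z, q) := rfl
    _ ≤ Δ.returnProb p Z q +
          ∑ r, ∑ α, Δ.wt p Z r α * Δ.emptyingSum Nat.cast r α.toList q := by
        rw [deriv_quadraticSystem_apply]
        gcongr with r
        rw [StackWord.sum_eq, add_assoc]
        refine le_add_of_nonneg_of_le zero_le ?_
        gcongr with Y _ Y _ X
        · exact (hone r Y).le
        · exact htwo r Y X
    _ = Δ.momentVec (p, Z, q) := (Δ.firstMoment_eq_returnProb_add p Z q).symm

end QuadraticSystem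

section Extrema

lemma IsCPAST.maxCondRuntime_lt_top {Δ : PPDA Q Γ} (hΔ : Δ.IsCPAST) : Δ.maxCondRuntime < ⊤ := by
  simp only [maxCondRuntime, ← Finset.sup_univ_eq_iSup, Finset.sup_lt_iff ENNReal.zero_lt_top]
  intro p _ Z _ q _
  by_cases h : Δ.returnProb p Z q = 0
  · simp [h]
  · simpa [h] using hΔ p Z q h

lemma minReturnProb_pos (Δ : PPDA Q Γ) : 0 < Δ.minReturnProb := by
  simp only [minReturnProb, ← Finset.inf_univ_eq_iInf, Finset.lt_inf_iff ENNReal.zero_lt_top]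
  intro p _ Z _ q _
  by_cases h : Δ.returnProb p Z q = 0
  · simp [h]
  · simpa [h] using pos_iff_ne_zero.2 h

lemma condRuntime_le_maxCondRuntime (Δ : PPDA Q Γ) {p : Q} {Z : Γ} {q : Q}
    (h : Δ.returnProb p Z q ≠ 0) : Δ.condRuntime p Z q ≤ Δ.maxCondRuntime :=
  le_iSup_of_le p <| le_iSup_of_le Z <| le_iSup_of_le q <|
    le_iSup (fun _ : Δ.returnProb p Z q ≠ 0 => Δ.condRuntime p Z q) h

lemma minReturnProb_le_returnProb (Δ : PPDA Q Γ) {p : Q} {Z : Γ} {q : Q}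
    (h : Δ.returnProb p Z q ≠ 0) : Δ.minReturnProb ≤ Δ.returnProb p Z q :=
  iInf_le_of_le p <| iInf_le_of_le Z <| iInf_le_of_le q <| iInf_le _ h

lemma returnProb_ne_top (Δ : PPDA Q Γ) (p : Q) (Z : Γ) (q : Q) : Δ.returnProb p Z q ≠ ⊤ :=
  ne_top_of_le_ne_top ENNReal.one_ne_top (Δ.returnProb_le_one p Z q)

lemma firstMoment_le_mul_returnProb (Δ : PPDA Q Γ) (p : Q) (Z : Γ) (q : Q) :
    Δ.firstMoment p Z q ≤ Δ.maxCondRuntime * Δ.returnProb p Z q := by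
  by_cases h : Δ.returnProb p Z q = 0
  · simp [Δ.firstMoment_eq_zero h]
  · exact (ENNReal.div_le_iff h (Δ.returnProb_ne_top p Z q)).1 (Δ.condRuntime_le_maxCondRuntime h)

lemma one_le_condRuntime (Δ : PPDA Q Γ) {p : Q} {Z : Γ} {q : Q} (h : Δ.returnProb p Z q ≠ 0) :
    1 ≤ Δ.condRuntime p Z q := by
  rw [condRuntime, ENNReal.le_div_iff_mul_le (.inl h) (.inl (Δ.returnProb_ne_top p Z q)), one_mul,
    firstMoment_eq_returnProb_add]
  exact le_self_add

lemma exists_momentVec_le_smul {Δ : PPDA Q Γ} (hΔ : Δ.IsCPAST) :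
    ∃ C : ℝ≥0, 1 ≤ C ∧ Δ.momentVec ≤ C • Δ.returnVec ∧
      Real.log C = Real.log Δ.maxCondRuntime.toReal := by
  obtain ⟨c, hc⟩ : ∃ c : ℝ≥0, (c : ℝ≥0∞) = Δ.maxCondRuntime :=
    WithTop.ne_top_iff_exists.1 hΔ.maxCondRuntime_lt_top.ne
  refine ⟨max 1 c, le_max_left _ _, ?_, ?_⟩
  · rintro ⟨p, Z, q⟩
    calc Δ.firstMoment p Z q ≤ c * Δ.returnProb p Z q := by
          rw [hc]
          exact Δ.firstMoment_le_mul_returnProb p Z q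
      _ ≤ (max 1 c : ℝ≥0) * Δ.returnProb p Z q := by
          gcongr
          exact le_max_right _ _
  · rw [← hc, ENNReal.coe_toReal]
    by_cases h : ∃ p Z q, Δ.returnProb p Z q ≠ 0
    · obtain ⟨p, Z, q, h⟩ := h
      have hc1 : 1 ≤ c := by
        rw [← ENNReal.coe_le_coe, hc]
        exact (Δ.one_le_condRuntime h).trans (Δ.condRuntime_le_maxCondRuntime h)
      rw [max_eq_right hc1]
    · push Not at h
      have hc0 : c = 0 := by
        rw [← ENNReal.coe_eq_zero, hc]
        simp [maxCondRuntime, h]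
      simp [hc0]

lemma exists_le_returnProb (Δ : PPDA Q Γ) :
    ∃ m : ℝ≥0, 0 < m ∧ m ≤ 1 ∧ (∀ i, Δ.returnVec i ≠ 0 → m ≤ Δ.returnVec i) ∧
      Real.log (1 / m) = Real.log (1 / Δ.minReturnProb.toReal) := by
  by_cases h : ∃ p Z q, Δ.returnProb p Z q ≠ 0
  · obtain ⟨p, Z, q, h⟩ := h
    have hle : Δ.minReturnProb ≤ 1 :=
      (Δ.minReturnProb_le_returnProb h).trans (Δ.returnProb_le_one p Z q)
    obtain ⟨m, hm⟩ : ∃ m : ℝ≥0, (m : ℝ≥0∞) = Δ.minReturnProb :=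
      WithTop.ne_top_iff_exists.1 (ne_top_of_le_ne_top ENNReal.one_ne_top hle)
    refine ⟨m, ?_, ?_, fun i hi => ?_, ?_⟩
    · exact ENNReal.coe_pos.1 (hm ▸ Δ.minReturnProb_pos)
    · exact ENNReal.coe_le_one_iff.1 (hm ▸ hle)
    · exact hm ▸ Δ.minReturnProb_le_returnProb hi
    · rw [← hm, ENNReal.coe_toReal]
  · push Not at h
    refine ⟨1, one_pos, le_rfl, fun i hi => absurd (h _ _ _) hi, ?_⟩
    simp [minReturnProb, h]

end Extrema

theorem exists_nnrat_fundamental_le {Δ : PPDA Q Γ} (hΔ : Δ.IsCPAST) {ε : ℝ≥0} (hε : 0 < ε) :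
    ∃ a : Q × Γ × Q → ℚ≥0, let u : Q × Γ × Q → ℝ≥0∞ := fun i => ((a i : ℝ≥0) : ℝ≥0∞)
      Δ.fundamental u ≤ u ∧ Δ.lfp ≤ u ∧ u ≤ (1 + ε) • Δ.lfp ∧
      ∀ i, ((Nat.size (a i).num + Nat.size (a i).den : ℕ) : ℝ) ≤
        15 * (Real.log Δ.maxCondRuntime.toReal + Real.log (1 / Δ.minReturnProb.toReal)
          + max 0 (Real.log (1 / ε)) + 1) := by
  obtain ⟨C, hC, hmoment, hlogC⟩ := exists_momentVec_le_smul hΔ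
  obtain ⟨m, hm0, hm1, hm, hlogm⟩ := Δ.exists_le_returnProb
  rw [lfp_eq_returnVec, ← hlogC, ← hlogm]
  simp only [← eval_quadraticSystem]
  exact Δ.quadraticSystem.exists_nnrat_eval_le_of_le_smul
    ((Δ.eval_quadraticSystem _).trans_le Δ.fundamental_returnVec_le)
    (fun ⟨p, Z, q⟩ => Δ.returnProb_le_one p Z q) Δ.returnVec_add_deriv_le hmoment hC hm0 hm1 hm hε

end PPDA

lemma norm_toReal_sub_le {ι : Type*} [Fintype ι] {r : ι → ℝ≥0∞} {a : ι → ℝ≥0} {ε : ℝ≥0}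
    (hr1 : r ≤ 1) (hra : r ≤ fun i => (a i : ℝ≥0∞)) (har : (fun i => (a i : ℝ≥0∞)) ≤ (1 + ε) • r) :
    ‖fun i => (r i).toReal - a i‖ ≤ ε := by
  lift r to ι → ℝ≥0 using fun i => ne_top_of_le_ne_top ENNReal.one_ne_top (hr1 i)
  refine (pi_norm_le_iff_of_nonneg ε.coe_nonneg).2 fun i => ?_
  have hr1i : r i ≤ 1 := ENNReal.coe_le_coe.1 (hr1 i)
  have hrai : r i ≤ a i := ENNReal.coe_le_coe.1 (hra i)
  have hari : a i ≤ r i + ε :=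
    calc a i ≤ (1 + ε) * r i := ENNReal.coe_le_coe.1 (har i)
      _ = r i + ε * r i := by ring
      _ ≤ r i + ε := by gcongr; exact mul_le_of_le_one_right' hr1i
  have hsub : (a i : ℝ) - r i ≤ ε := sub_le_iff_le_add'.2 (mod_cast hari)
  simpa only [ENNReal.coe_toReal, Real.norm_eq_abs, abs_sub_comm,
    abs_of_nonneg (sub_nonneg.2 (NNReal.coe_le_coe.2 hrai))] using hsub

theorem theorem9_general {Q : Type u} {Γ : Type v} [Fintype Q] [Fintype Γ] (Δ : PPDA Q Γ)
    (hΔ : Δ.IsCPAST) {ε : ℝ} (hε : 0 < ε) :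
    ∃ a : Q × Γ × Q → ℚ≥0,
      Δ.fundamental (fun x => ((a x : ℝ≥0) : ℝ≥0∞)) ≤ (fun x => ((a x : ℝ≥0) : ℝ≥0∞)) ∧
      (∀ x, Δ.lfp x ≠ ⊤) ∧
      ‖fun x => (Δ.lfp x).toReal - (a x : ℝ)‖ ≤ ε ∧
      ∀ x, ((Nat.size (a x).num + Nat.size (a x).den : ℕ) : ℝ) ≤
        15 * (Real.log Δ.maxCondRuntime.toReal + Real.log (1 / Δ.minReturnProb.toReal)
          + max 0 (Real.log (1 / ε)) + 1) := by
  lift ε to ℝ≥0 using hε.le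
  obtain ⟨a, hfa, hle, hge, hsize⟩ := PPDA.exists_nnrat_fundamental_le hΔ (NNReal.coe_pos.1 hε)
  have hlfp1 : Δ.lfp ≤ 1 := by
    rw [Δ.lfp_eq_returnVec]
    exact fun ⟨p, Z, q⟩ => Δ.returnProb_le_one p Z q
  have hnorm := norm_toReal_sub_le (a := fun x => (a x : ℝ≥0)) hlfp1 hle hge
  exact ⟨a, hfa, fun x => ne_top_of_le_ne_top ENNReal.one_ne_top (hlfp1 x), hnorm, hsize⟩

theorem theorem9 :
    ∃ K : ℝ, ∀ (Q : Type u) (Γ : Type v) [Fintype Q] [Fintype Γ] (Δ : PPDA Q Γ),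
      Δ.IsCPAST → ∀ ε : ℝ, 0 < ε →
        ∃ a : Q × Γ × Q → ℚ≥0,
          Δ.fundamental (fun x => ((a x : ℝ≥0) : ℝ≥0∞)) ≤ (fun x => ((a x : ℝ≥0) : ℝ≥0∞)) ∧
          (∀ x, Δ.lfp x ≠ ⊤) ∧
          ‖fun x => (Δ.lfp x).toReal - (a x : ℝ)‖ ≤ ε ∧
          ∀ x, ((Nat.size (a x).num + Nat.size (a x).den : ℕ) : ℝ) ≤
            K * (Real.log Δ.maxCondRuntime.toReal + Real.log (1 / Δ.minReturnProb.toReal)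
              + Real.log (Fintype.card Q) + Real.log (Fintype.card Γ)
              + max 0 (Real.log (1 / ε)) + 1) := by
  refine ⟨15, fun Q Γ _ _ Δ hΔ ε hε => ?_⟩
  obtain ⟨a, hfa, hlfp, hnorm, hsize⟩ := theorem9_general Δ hΔ hε
  refine ⟨a, hfa, hlfp, hnorm, fun x => (hsize x).trans ?_⟩
  linarith [Real.log_natCast_nonneg (Fintype.card Q), Real.log_natCast_nonneg (Fintype.card Γ)]
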